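/- Let $p\ge 1$, let $\|\cdot\|$ be any norm on $\mathbb R^p$, let $S_0=\{x:\|x\|\le 1\}$ and let $\beta=\lambda(S_0)$ be its Lebesgue measure. Let $f$ be a probability density on $\mathbb R^p$ and $z\in\mathbb R^p$ a point with $f(z)>0$ such that $f$ is of class $C^2$ at $z$ with non-singular Hessian; that is, the partial derivatives of $f$ of first and second order exist in a neighbourhood of $z$, those of second order are continuous at $z$, and the matrix $H(z)$ of second order partial derivatives at $z$ is non-singular. Let $K$ be a (measurable) bounded non-negative function on $S_0$ with $$\int_{S_0}K(x)\,dx=\beta,\qquad \int_{S_0}x\,K(x)\,dx=0 .$$ Let $X_1,X_2,\dots$ be independent random vectors with density $f$. For $\mu=\mu(n)>0$ let $S(\mu)=\{x:\|x-z\|\le\mu\}$ and define the kernel estimator $$g_n(z)=\frac{1}{\lambda(S(\mu))}\cdot\frac1n\sum_{j\le n,\;X_j\in S(\mu)}K\!\left(\frac{X_j-z}{\mu}\right).$$ Suppose that $k=k(n)=\lfloor n\mu(n)^p\rfloor$ satisfies $\lim_{n\to\infty}n^{-4/(p+4)}k=a$ for some $a>0$. Put $Z_n=\sqrt{k}\,(g_n(z)-f(z))$,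 $$B(z)=\frac{a^{\frac{p+4}{2p}}}{2}\,\beta^{-1}\int_{S_0}x^{T}H(z)x\,K(x)\,dx,\qquad V(z)=f(z)\,\beta^{-2}\int_{S_0}K^2(x)\,dx .$$ Then $V(z)>0$ and $Z_n$ converges in distribution to the normal law with mean $B(z)$ and variance $V(z)$: for every $t\in\mathbb R$, $$\lim_{n\to\infty}P(Z_n\le t)=\int_{-\infty}^{t}\frac{1}{\sqrt{2\pi V(z)}}\exp\left(-\frac{(y-B(z))^2}{2V(z)}\right)dy .$$ -/

import Mathlib

open MeasureTheory ProbabilityTheory Filter Topology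
open scoped Matrix

noncomputable section

/-- The second order partial derivative `∂ⱼ ∂ᵢ f (x)` of a function on `ℝᵖ`
(meaningful where the partial derivatives exist, see `IsC2At`). -/
def secondPartial {p : ℕ} (f : (Fin p → ℝ) → ℝ) (i j : Fin p) (x : Fin p → ℝ) : ℝ :=
  lineDeriv ℝ (fun y => lineDeriv ℝ f y (Pi.single i 1)) x (Pi.single j 1)

/-- The Hessian matrix of second order partial derivatives of `f` at `z`. -/
def hessian {p : ℕ} (f : (Fin p → ℝ) → ℝ) (z : Fin p → ℝ) : Matrix (Fin p) (Fin p) ℝ :=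
  Matrix.of fun i j => secondPartial f i j z

/-- `f` is of class `C²` at `z`: all partial derivatives of first and second order exist in a
neighbourhood of `z`, and those of second order are continuous at `z`. -/
structure IsC2At {p : ℕ} (f : (Fin p → ℝ) → ℝ) (z : Fin p → ℝ) : Prop where
  first_exists : ∀ᶠ x in 𝓝 z, ∀ i : Fin p, LineDifferentiableAt ℝ f x (Pi.single i 1)
  second_exists : ∀ᶠ x in 𝓝 z, ∀ i j : Fin p,
    LineDifferentiableAt ℝ (fun y => lineDeriv ℝ f y (Pi.single i 1)) x (Pi.single j 1)
  second_continuousAt : ∀ i j : Fin p, ContinuousAt (secondPartial f i j) z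

/-- `f` is a probability density function on `ℝᵖ` with respect to Lebesgue measure. -/
structure IsPdf {p : ℕ} (f : (Fin p → ℝ) → ℝ) : Prop where
  measurable : Measurable f
  nonneg : ∀ x, 0 ≤ f x
  lintegral_eq_one : ∫⁻ x, ENNReal.ofReal (f x) = 1

/-- The volume `β` of the closed unit ball of `N`. -/
def unitBallVolume {p : ℕ} (N : Seminorm ℝ (Fin p → ℝ)) : ℝ :=
  volume.real (N.closedBall 0 1)

/-- `K` is a kernel on the closed unit ball of `N`: it is bounded and non-negative there, its
integral over the ball is the volume of the ball, and its first moment vanishes. The values of `K`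
outside the ball play no role. -/
structure IsKernel {p : ℕ} (N : Seminorm ℝ (Fin p → ℝ)) (K : (Fin p → ℝ) → ℝ) : Prop where
  measurable : Measurable K
  nonneg : ∀ x ∈ N.closedBall 0 1, 0 ≤ K x
  bounded : ∃ C : ℝ, ∀ x ∈ N.closedBall 0 1, K x ≤ C
  integral_eq : ∫ x in N.closedBall 0 1, K x = unitBallVolume N
  first_moment_eq_zero : ∫ x in N.closedBall 0 1, K x • x = 0

/-- The weighted mass `M_μ = (1/n) ∑_{x_j ∈ S(μ)} K((x_j - z)/μ)`, where `S(μ)` is the closed ball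
of radius `μ` about `z` and the sum is over the first `n` data points. -/
def kernelMass {p : ℕ} (N : Seminorm ℝ (Fin p → ℝ)) (K : (Fin p → ℝ) → ℝ) (μ : ℝ) (n : ℕ)
    (x : ℕ → Fin p → ℝ) (z : Fin p → ℝ) : ℝ :=
  (1 / (n : ℝ)) * ∑ j ∈ Finset.range n,
    (N.closedBall z μ).indicator (fun y => K (μ⁻¹ • (y - z))) (x j)

/-- The kernel density estimator `g_n(z) = M_μ / λ(S(μ))`. -/
def kernelEstimator {p : ℕ} (N : Seminorm ℝ (Fin p → ℝ)) (K : (Fin p → ℝ) → ℝ) (μ : ℝ) (n : ℕ)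
    (x : ℕ → Fin p → ℝ) (z : Fin p → ℝ) : ℝ :=
  kernelMass N K μ n x z / volume.real (N.closedBall z μ)

/-- The asymptotic bias `B(z)`. -/
def kernelBias {p : ℕ} (N : Seminorm ℝ (Fin p → ℝ)) (K f : (Fin p → ℝ) → ℝ) (a : ℝ)
    (z : Fin p → ℝ) : ℝ :=
  (a ^ (((p : ℝ) + 4) / (2 * (p : ℝ))) / 2) *
    ((unitBallVolume N)⁻¹ * ∫ x in N.closedBall 0 1, (x ⬝ᵥ (hessian f z *ᵥ x)) * K x)

/-- The asymptotic variance `V(z)`. -/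
def kernelVariance {p : ℕ} (N : Seminorm ℝ (Fin p → ℝ)) (K f : (Fin p → ℝ) → ℝ)
    (z : Fin p → ℝ) : ℝ :=
  f z * ((unitBallVolume N ^ 2)⁻¹ * ∫ x in N.closedBall 0 1, K x ^ 2)

end

/-! `Z_n` is exactly a row sum of i.i.d. variables `ξ n j = c n * Y n j - e n`, where `Y n j` is the
kernel weight of the `j`-th observation. They are bounded by a constant times `k^(-1/2) + √k / n`,
which tends to `0`, so the limit law is governed by the limits of `n E ξ` and `n E ξ²` alone. Indeed
`E exp(itξ) = 1 + it E ξ - t²/2 E ξ² + o(1/n)`, and the `n`-th power converges to the characteristic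
function of a normal law (`tendsto_charFun_sum_of_bounded`); Lévy's continuity theorem and the
portmanteau theorem then give the distribution functions
(`tendsto_measureReal_le_of_tendsto_charFun`).

Both moments are computed by the substitution `x = z + μu`. In the mean, the Taylor expansion of `f`
at `z` loses its constant term because `K` has integral `β` and its linear term because the first
moment of `K` vanishes; the Hessian term remains, at scale `√k μ²` (`IsKernel.tendsto_bias`). The
growth of `k` is the one for which `√k μ²` has a finite positive limit, so that bias and fluctuation
have the same order (`bandwidth_asymptotics`). In the second moment only the square of the weight
survives, since `k/n → 0`.

The Taylor expansion (`IsC2At.taylor`) is delicate because the second partial derivatives are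
continuous only at `z` itself. -/

/-! ### Partial derivatives and the second order Taylor expansion -/

/-- The restriction of a function to a coordinate line is differentiable with derivative the
partial derivative. -/
theorem HasLineDerivAt.hasDerivAt_update {p : ℕ} {g : (Fin p → ℝ) → ℝ} {w : Fin p → ℝ} {i : Fin p}
    {d τ : ℝ} (h : HasLineDerivAt ℝ g d (Function.update w i τ) (Pi.single i 1)) :
    HasDerivAt (fun s => g (Function.update w i s)) d τ := by
  have h1 : HasDerivAt (fun t : ℝ => g (Function.update w i τ + t • Pi.single i (1 : ℝ))) d (τ - τ) := by
    rw [sub_self]; exact h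
  have h2 := h1.comp_sub_const τ τ
  refine h2.congr_of_eventuallyEq (Eventually.of_forall fun s => ?_)
  simp only
  congr 1
  ext j
  by_cases hj : j = i
  · subst hj; simp
  · simp [hj]

/-- Mean value inequality on a cube in terms of partial derivatives. -/
theorem abs_sub_sub_sum_partial_le {p : ℕ} {g : (Fin p → ℝ) → ℝ} {z : Fin p → ℝ} {r ε : ℝ}
    {d : Fin p → (Fin p → ℝ) → ℝ} {c : Fin p → ℝ}
    (hd : ∀ x ∈ Metric.ball z r, ∀ i, HasLineDerivAt ℝ g (d i x) x (Pi.single i 1))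
    (hc : ∀ x ∈ Metric.ball z r, ∀ i, |d i x - c i| ≤ ε)
    {x y : Fin p → ℝ} (hx : x ∈ Metric.ball z r) (hy : y ∈ Metric.ball z r) :
    |g y - g x - ∑ i, c i * (y i - x i)| ≤ ε * ∑ i, |y i - x i| := by
  have hr : 0 < r := Metric.pos_of_mem_ball hx
  have hx' := (dist_pi_lt_iff hr).1 hx
  have hy' := (dist_pi_lt_iff hr).1 hy
  -- Passage from `x` to `y` changes one coordinate at a time; `s` is the set of coordinates already
  -- changed. Balls of the sup norm are cubes, so the intermediate points stay inside.
  have main : ∀ s : Finset (Fin p),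
      |g (s.piecewise y x) - g x - ∑ i ∈ s, c i * (y i - x i)| ≤ ε * ∑ i ∈ s, |y i - x i| := by
    intro s
    induction s using Finset.induction_on with
    | empty => simp
    | insert i s his ih =>
      set w := s.piecewise y x with hw
      have hwx : w i = x i := by simp [hw, his]
      have hw' : ∀ j, dist (w j) (z j) < r := fun j => by
        by_cases hj : j ∈ s <;> simp [hw, hj, hx', hy']
      have hmem : ∀ τ ∈ Metric.ball (z i) r, Function.update w i τ ∈ Metric.ball z r := by
        intro τ hτ
        refine (dist_pi_lt_iff hr).2 fun j => ?_
        by_cases hj : j = i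
        · subst hj; simpa using hτ
        · simpa [hj] using hw' j
      have key : ‖(g (Function.update w i (y i)) - c i * y i)
          - (g (Function.update w i (x i)) - c i * x i)‖ ≤ ε * ‖y i - x i‖ := by
        refine (convex_ball (z i) r).norm_image_sub_le_of_norm_hasDerivWithin_le
          (f := fun τ => g (Function.update w i τ) - c i * τ)
          (f' := fun τ => d i (Function.update w i τ) - c i) ?_ ?_ (hx' i) (hy' i)
        · intro τ hτ
          have h1 := (hd _ (hmem τ hτ) i).hasDerivAt_update
          have h2 : HasDerivAt (fun τ : ℝ => c i * τ) (c i) τ := by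
            simpa using (hasDerivAt_id τ).const_mul (c i)
          exact (h1.sub h2).hasDerivWithinAt
        · intro τ hτ
          exact hc _ (hmem τ hτ) i
      rw [← hwx, Function.update_eq_self, hwx, Real.norm_eq_abs, Real.norm_eq_abs] at key
      rw [Finset.piecewise_insert, Finset.sum_insert his, Finset.sum_insert his, mul_add]
      refine le_trans (le_of_eq ?_) ((abs_add_le _ _).trans (add_le_add key ih))
      congr 1
      ring
  simpa using main Finset.univ

/-- A function whose partial derivatives exist near `z` and are continuous at `z` is Fréchet
differentiable at `z`. -/
theorem hasFDerivAt_of_continuousAt_partial {p : ℕ} {g : (Fin p → ℝ) → ℝ} {z : Fin p → ℝ}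
    (hd : ∀ᶠ x in 𝓝 z, ∀ i, LineDifferentiableAt ℝ g x (Pi.single i 1))
    (hc : ∀ i, ContinuousAt (fun x => lineDeriv ℝ g x (Pi.single i 1)) z) :
    HasFDerivAt g (∑ i, lineDeriv ℝ g z (Pi.single i 1) •
      (ContinuousLinearMap.proj i : (Fin p → ℝ) →L[ℝ] ℝ)) z := by
  rw [hasFDerivAt_iff_isLittleO, Asymptotics.isLittleO_iff]
  intro ε hε
  -- The sum of the coordinate increments is at most `p` times the sup norm; `p + 1` also avoids
  -- division by zero when `p = 0`.
  have hε' : 0 < ε / (p + 1) := by positivity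
  have h1 : ∀ᶠ x in 𝓝 z, ∀ i, |lineDeriv ℝ g x (Pi.single i 1) - lineDeriv ℝ g z (Pi.single i 1)|
      ≤ ε / (p + 1) := by
    rw [eventually_all]
    intro i
    filter_upwards [(hc i).eventually (Metric.closedBall_mem_nhds _ hε')] with x hx
    exact hx
  obtain ⟨r, hr, hball⟩ := Metric.eventually_nhds_iff_ball.1 (hd.and h1)
  filter_upwards [Metric.ball_mem_nhds z hr] with y hy
  have h2 := abs_sub_sub_sum_partial_le (g := g) (z := z) (r := r) (ε := ε / (p + 1))
    (d := fun i x => lineDeriv ℝ g x (Pi.single i 1))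
    (c := fun i => lineDeriv ℝ g z (Pi.single i 1))
    (fun x hx i => ((hball x hx).1 i).hasLineDerivAt) (fun x hx i => (hball x hx).2 i)
    (Metric.mem_ball_self hr) hy
  have h3 : ∑ i, |y i - z i| ≤ p * ‖y - z‖ := by
    calc ∑ i, |y i - z i| ≤ ∑ _i : Fin p, ‖y - z‖ :=
          Finset.sum_le_sum fun i _ => norm_le_pi_norm (y - z) i
      _ = p * ‖y - z‖ := by simp
  rw [Real.norm_eq_abs]
  simp only [sum_apply, smul_apply,
    ContinuousLinearMap.proj_apply, smul_eq_mul, Pi.sub_apply]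
  refine h2.trans ((mul_le_mul_of_nonneg_left h3 hε'.le).trans ?_)
  have : ε / (p + 1) * p ≤ ε := by
    rw [div_mul_eq_mul_div, div_le_iff₀ (by positivity)]
    nlinarith
  nlinarith [norm_nonneg (y - z)]

/-- A function whose partial derivatives exist near `z` and are continuous at `z` is continuous
near `z`. -/
theorem eventually_continuousAt_of_continuousAt_partial {p : ℕ} {g : (Fin p → ℝ) → ℝ}
    {z : Fin p → ℝ} (hd : ∀ᶠ x in 𝓝 z, ∀ i, LineDifferentiableAt ℝ g x (Pi.single i 1))
    (hc : ∀ i, ContinuousAt (fun x => lineDeriv ℝ g x (Pi.single i 1)) z) :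
    ∀ᶠ x in 𝓝 z, ContinuousAt g x := by
  have h1 : ∀ᶠ x in 𝓝 z, ∀ i, |lineDeriv ℝ g x (Pi.single i 1) - lineDeriv ℝ g z (Pi.single i 1)|
      ≤ 1 := by
    rw [eventually_all]
    intro i
    filter_upwards [(hc i).eventually (Metric.closedBall_mem_nhds _ one_pos)] with x hx
    exact hx
  obtain ⟨r, hr, hball⟩ := Metric.eventually_nhds_iff_ball.1 (hd.and h1)
  filter_upwards [Metric.ball_mem_nhds z hr] with x hx
  set c : Fin p → ℝ := fun i => lineDeriv ℝ g z (Pi.single i 1)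
  have hcont : Tendsto (fun y : Fin p → ℝ => 1 * ∑ i, |y i - x i| + |∑ i, c i * (y i - x i)|)
      (𝓝 x) (𝓝 0) := by
    have : Continuous (fun y : Fin p → ℝ =>
        1 * ∑ i, |y i - x i| + |∑ i, c i * (y i - x i)|) := by fun_prop
    simpa using this.tendsto x
  rw [ContinuousAt, tendsto_iff_dist_tendsto_zero]
  refine squeeze_zero' (Eventually.of_forall fun _ => dist_nonneg) ?_ hcont
  filter_upwards [Metric.isOpen_ball.mem_nhds hx] with y hy
  have h2 := abs_sub_sub_sum_partial_le (g := g) (z := z) (r := r) (ε := 1)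
    (d := fun i x => lineDeriv ℝ g x (Pi.single i 1)) (c := c)
    (fun x hx i => ((hball x hx).1 i).hasLineDerivAt) (fun x hx i => (hball x hx).2 i) hx hy
  rw [Real.dist_eq]
  have h3 := abs_add_le (g y - g x - ∑ i, c i * (y i - x i)) (∑ i, c i * (y i - x i))
  rw [sub_add_cancel] at h3
  linarith

/-- The second order Taylor expansion at a point of class `C²`. -/
theorem IsC2At.taylor {p : ℕ} {f : (Fin p → ℝ) → ℝ} {z : Fin p → ℝ} (hf : IsC2At f z) :
    ∃ L : (Fin p → ℝ) →L[ℝ] ℝ, ∀ ε > 0, ∃ δ > 0, ∀ h : Fin p → ℝ, ‖h‖ < δ →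
      |f (z + h) - f z - L h - 1 / 2 * (h ⬝ᵥ (hessian f z *ᵥ h))| ≤ ε * ‖h‖ ^ 2 := by
  set g : Fin p → (Fin p → ℝ) → ℝ := fun i y => lineDeriv ℝ f y (Pi.single i 1) with hg
  -- Continuity of the second partials at `z` makes the first partials differentiable at `z` and
  -- continuous near `z`; the latter makes `f` differentiable near `z`.
  have hgF : ∀ i, HasFDerivAt (g i) (∑ j, hessian f z i j •
      (ContinuousLinearMap.proj j : (Fin p → ℝ) →L[ℝ] ℝ)) z := fun i =>
    hasFDerivAt_of_continuousAt_partial (hf.second_exists.mono fun x hx j => hx i j)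
      (hf.second_continuousAt i)
  have hgc : ∀ᶠ x in 𝓝 z, ∀ i, ContinuousAt (g i) x := by
    rw [eventually_all]
    exact fun i => eventually_continuousAt_of_continuousAt_partial
      (hf.second_exists.mono fun x hx j => hx i j) (hf.second_continuousAt i)
  have hfF : ∀ᶠ x in 𝓝 z, HasFDerivAt f (∑ i, g i x •
      (ContinuousLinearMap.proj i : (Fin p → ℝ) →L[ℝ] ℝ)) x := by
    filter_upwards [hgc, hf.first_exists.eventually_nhds] with x hx hx'
    exact hasFDerivAt_of_continuousAt_partial hx' hx
  refine ⟨∑ i, g i z • (ContinuousLinearMap.proj i : (Fin p → ℝ) →L[ℝ] ℝ), fun ε hε => ?_⟩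
  have hε' : 0 < ε / (p + 1) := by positivity
  have hexp : ∀ᶠ x in 𝓝 z, ∀ i, |g i x - g i z - ∑ j, hessian f z i j * (x j - z j)|
      ≤ ε / (p + 1) * ‖x - z‖ := by
    rw [eventually_all]
    intro i
    have := (Asymptotics.isLittleO_iff.1 (hasFDerivAt_iff_isLittleO.1 (hgF i))) hε'
    filter_upwards [this] with x hx
    simpa [sum_apply] using hx
  obtain ⟨δ, hδ, hball⟩ := Metric.eventually_nhds_iff_ball.1 (hfF.and hexp)
  refine ⟨δ, hδ, fun h hh => ?_⟩
  set Lh : ℝ := ∑ i, g i z * h i with hLh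
  set Qh : ℝ := h ⬝ᵥ (hessian f z *ᵥ h) with hQh
  have hQ : Qh = ∑ i, (∑ j, hessian f z i j * h j) * h i := by
    simp [hQh, dotProduct, Matrix.mulVec, mul_comm]
  have hmem : ∀ t ∈ Set.Icc (0 : ℝ) 1, z + t • h ∈ Metric.ball z δ := by
    intro t ht
    rw [mem_ball_iff_norm, add_sub_cancel_left, norm_smul, Real.norm_eq_abs, abs_of_nonneg ht.1]
    nlinarith [norm_nonneg h, ht.2]
  -- Mean value inequality along the segment for `f(z + th) - t Lh - t²/2 Qh`. Its derivative is the
  -- first order remainder of the gradient paired with `h`, so symmetry of the Hessian is not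
  -- needed.
  have key : ‖(f (z + (1 : ℝ) • h) - 1 * Lh - 1 / 2 * (1 : ℝ) ^ 2 * Qh)
      - (f (z + (0 : ℝ) • h) - 0 * Lh - 1 / 2 * (0 : ℝ) ^ 2 * Qh)‖
      ≤ ε * ‖h‖ ^ 2 * ‖(1 : ℝ) - 0‖ := by
    refine (convex_Icc (0 : ℝ) 1).norm_image_sub_le_of_norm_hasDerivWithin_le
      (f := fun t => f (z + t • h) - t * Lh - 1 / 2 * t ^ 2 * Qh)
      (f' := fun t => ∑ i, (g i (z + t • h) - g i z - ∑ j, hessian f z i j * (t * h j)) * h i)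
      ?_ ?_ (by simp) (by simp)
    · intro t ht
      have h1 : HasDerivAt (fun t : ℝ => z + t • h) h t := by
        simpa using ((hasDerivAt_id t).smul_const h).const_add z
      have h2 := (hball _ (hmem t ht)).1.comp_hasDerivAt t h1
      have h3 : HasDerivAt (fun t : ℝ => t * Lh) Lh t := by
        simpa using (hasDerivAt_id t).mul_const Lh
      have h4 : HasDerivAt (fun t : ℝ => 1 / 2 * t ^ 2 * Qh) (t * Qh) t := by
        have := ((hasDerivAt_pow 2 t).const_mul (1 / 2 : ℝ)).mul_const Qh
        refine this.congr_deriv ?_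
        simp
      refine ((h2.sub h3).sub h4).hasDerivWithinAt.congr_deriv ?_
      simp only [sum_apply, smul_apply,
        ContinuousLinearMap.proj_apply, smul_eq_mul]
      rw [hLh, hQ, Finset.mul_sum, ← Finset.sum_sub_distrib, ← Finset.sum_sub_distrib]
      refine Finset.sum_congr rfl fun i _ => ?_
      have : ∑ j, hessian f z i j * (t * h j) = t * ∑ j, hessian f z i j * h j := by
        rw [Finset.mul_sum]
        exact Finset.sum_congr rfl fun j _ => by ring
      rw [this]; ring
    · intro t ht
      have hb := (hball _ (hmem t ht)).2
      have hth : ‖t • h‖ ≤ ‖h‖ := by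
        rw [norm_smul, Real.norm_eq_abs, abs_of_nonneg ht.1]
        nlinarith [norm_nonneg h, ht.2]
      refine (norm_sum_le _ _).trans ?_
      have hterm : ∀ i ∈ Finset.univ,
          ‖(g i (z + t • h) - g i z - ∑ j, hessian f z i j * (t * h j)) * h i‖
            ≤ ε / (p + 1) * ‖h‖ ^ 2 := by
        intro i _
        have hbi := hb i
        simp only [Pi.add_apply, Pi.smul_apply, smul_eq_mul, add_sub_cancel_left] at hbi
        rw [norm_mul, Real.norm_eq_abs, sq, ← mul_assoc]
        refine mul_le_mul (hbi.trans ?_) (norm_le_pi_norm h i) (norm_nonneg _) (by positivity)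
        exact mul_le_mul_of_nonneg_left hth hε'.le
      refine (Finset.sum_le_sum hterm).trans ?_
      rw [Finset.sum_const, Finset.card_univ, Fintype.card_fin, nsmul_eq_mul, ← mul_assoc]
      refine mul_le_mul_of_nonneg_right ?_ (by positivity)
      rw [mul_div_assoc', div_le_iff₀ (by positivity)]
      nlinarith
  have e1 : (∑ i, g i z • (ContinuousLinearMap.proj i : (Fin p → ℝ) →L[ℝ] ℝ)) h = Lh := by
    simp [hLh]
  rw [e1]
  simp only [one_smul, zero_smul, add_zero, sub_zero, norm_one, mul_one, one_mul, zero_mul,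
    one_pow, Real.norm_eq_abs] at key
  refine le_trans (le_of_eq ?_) key
  congr 1
  ring

/-! ### Characteristic functions and the central limit theorem for triangular arrays -/

/-- Second order Taylor estimate for the characteristic function of a bounded random variable. -/
theorem norm_charFun_sub_taylor_two_le {Ω : Type*} [MeasurableSpace Ω] {P : Measure Ω}
    [IsProbabilityMeasure P] {Y : Ω → ℝ} (hY : AEMeasurable Y P) {δ t : ℝ}
    (hb : ∀ᵐ ω ∂P, |Y ω| ≤ δ) (ht : |t| * δ ≤ 1) :
    ‖charFun (P.map Y) t - 1 - (t * (∫ ω, Y ω ∂P) * Complex.I - t ^ 2 / 2 * (∫ ω, Y ω ^ 2 ∂P))‖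
      ≤ |t| ^ 3 * δ * ∫ ω, Y ω ^ 2 ∂P := by
  have hYi : Integrable Y P := Integrable.of_bound hY.aestronglyMeasurable δ hb
  have hY2 : Integrable (fun ω => Y ω ^ 2) P := by
    refine Integrable.of_bound (hY.pow_const 2).aestronglyMeasurable (δ ^ 2) ?_
    filter_upwards [hb] with ω hω
    rw [Real.norm_eq_abs, abs_pow]
    exact pow_le_pow_left₀ (abs_nonneg _) hω 2
  have hexp : Integrable (fun ω => Complex.exp (t * Y ω * Complex.I)) P := by
    refine Integrable.of_bound ?_ 1 (Eventually.of_forall fun ω => ?_)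
    · exact AEMeasurable.aestronglyMeasurable (by fun_prop)
    · rw [← Complex.ofReal_mul, Complex.norm_exp_ofReal_mul_I]
  have hlin : Integrable (fun ω => (t * (Y ω : ℂ) * Complex.I - t ^ 2 / 2 * ((Y ω ^ 2 : ℝ) : ℂ))) P :=
    ((hYi.ofReal.const_mul _).mul_const _).sub (hY2.ofReal.const_mul _)
  have e1 : charFun (P.map Y) t = ∫ ω, Complex.exp (t * Y ω * Complex.I) ∂P := by
    rw [charFun_apply_real, integral_map hY]
    exact Continuous.aestronglyMeasurable (by fun_prop)
  have e2 : charFun (P.map Y) t - 1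
      - (t * (∫ ω, Y ω ∂P) * Complex.I - t ^ 2 / 2 * (∫ ω, Y ω ^ 2 ∂P))
      = ∫ ω, (Complex.exp (t * Y ω * Complex.I) - 1
        - (t * (Y ω : ℂ) * Complex.I - t ^ 2 / 2 * ((Y ω ^ 2 : ℝ) : ℂ))) ∂P := by
    have e3 := integral_sub (hexp.sub (integrable_const (1 : ℂ))) hlin
    simp only [Pi.sub_apply] at e3
    rw [e3, integral_sub hexp (integrable_const _),
      integral_sub ((hYi.ofReal.const_mul _).mul_const _) (hY2.ofReal.const_mul _), e1,
      integral_mul_const, integral_const_mul, integral_const_mul, integral_complex_ofReal, integral_complex_ofReal]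
    simp
  rw [e2, ← integral_const_mul]
  refine norm_integral_le_of_norm_le (hY2.const_mul _) ?_
  filter_upwards [hb] with ω hω
  have hn : ‖(t * Y ω * Complex.I : ℂ)‖ = |t| * |Y ω| := by simp
  have h1 : ‖(t * Y ω * Complex.I : ℂ)‖ ≤ 1 := by
    rw [hn]
    exact (mul_le_mul_of_nonneg_left hω (abs_nonneg t)).trans ht
  -- The cubic remainder has constant `4/18`, rounded up to `1` below; one factor `|Y|` is then
  -- bounded by `δ`, leaving `Y²`.
  have h2 := Complex.exp_bound h1 (n := 3) (by norm_num)
  have e3 : Complex.exp (t * Y ω * Complex.I) - 1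
        - (t * (Y ω : ℂ) * Complex.I - t ^ 2 / 2 * ((Y ω ^ 2 : ℝ) : ℂ))
      = Complex.exp (t * Y ω * Complex.I)
        - ∑ m ∈ Finset.range 3, (t * Y ω * Complex.I : ℂ) ^ m / (m.factorial : ℂ) := by
    simp only [Finset.sum_range_succ, Finset.sum_range_zero, mul_pow, Complex.I_sq]
    push_cast
    simp
    ring
  rw [e3]
  refine h2.trans ?_
  rw [hn]
  have h3 : (0 : ℝ) ≤ (|t| * |Y ω|) ^ 3 := by positivity
  have h4 : ((Nat.succ 3 : ℕ) : ℝ) * ((Nat.factorial 3 : ℕ) * (3 : ℕ) : ℝ)⁻¹ ≤ 1 := by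
    norm_num [Nat.factorial]
  calc (|t| * |Y ω|) ^ 3 * (((Nat.succ 3 : ℕ) : ℝ) * ((Nat.factorial 3 : ℕ) * (3 : ℕ) : ℝ)⁻¹)
      ≤ (|t| * |Y ω|) ^ 3 * 1 := mul_le_mul_of_nonneg_left h4 h3
    _ = |t| ^ 3 * |Y ω| * Y ω ^ 2 := by rw [← sq_abs (Y ω)]; ring
    _ ≤ |t| ^ 3 * δ * Y ω ^ 2 := by gcongr

/-- A central limit theorem for row sums of triangular arrays with independent identically
distributed rows that are uniformly small. -/
theorem tendsto_charFun_sum_of_bounded {Ω : Type*} [MeasurableSpace Ω] {P : Measure Ω}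
    [IsProbabilityMeasure P] {ξ : ℕ → ℕ → Ω → ℝ} {η : ℕ → Ω → ℝ}
    (hindep : ∀ n, iIndepFun (ξ n) P) (hident : ∀ n j, IdentDistrib (ξ n j) (η n) P P)
    {δ : ℕ → ℝ} (hδ : Tendsto δ atTop (𝓝 0)) (hb : ∀ n, ∀ᵐ ω ∂P, |η n ω| ≤ δ n) {B V : ℝ}
    (hB : Tendsto (fun n : ℕ => n * ∫ ω, η n ω ∂P) atTop (𝓝 B))
    (hV : Tendsto (fun n : ℕ => n * ∫ ω, η n ω ^ 2 ∂P) atTop (𝓝 V)) (t : ℝ) :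
    Tendsto (fun n : ℕ => charFun (P.map fun ω => ∑ j ∈ Finset.range n, ξ n j ω) t) atTop
      (𝓝 (Complex.exp (t * B * Complex.I - V * t ^ 2 / 2))) := by
  have hcf : ∀ n, charFun (P.map fun ω => ∑ j ∈ Finset.range n, ξ n j ω) t
      = (1 + (charFun (P.map (η n)) t - 1)) ^ n := by
    intro n
    rw [((hindep n).restrict _).charFun_map_fun_finsetSum_eq_prod
      (fun j _ => (hident n j).aemeasurable_fst)]
    simp [fun j => (hident n j).map_eq]
  simp_rw [hcf]
  -- `(1 + aₙ)ⁿ → exp A` as soon as `n aₙ → A`, so it remains to expand `n (φₙ(t) - 1)`.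
  refine Complex.tendsto_one_add_pow_exp_of_tendsto ?_
  have hmain : Tendsto (fun n : ℕ => ((t * (n * ∫ ω, η n ω ∂P : ℝ) * Complex.I
      - t ^ 2 / 2 * (n * ∫ ω, η n ω ^ 2 ∂P : ℝ) : ℂ))) atTop
      (𝓝 (t * B * Complex.I - V * t ^ 2 / 2)) := by
    have h1 := (Complex.continuous_ofReal.tendsto _).comp hB
    have h2 := (Complex.continuous_ofReal.tendsto _).comp hV
    have := ((h1.const_mul (t : ℂ)).mul_const Complex.I).sub (h2.const_mul ((t : ℂ) ^ 2 / 2))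
    refine this.trans_eq ?_
    congr 1; ring
  have hrem : Tendsto (fun n : ℕ => |t| ^ 3 * δ n * (n * ∫ ω, η n ω ^ 2 ∂P)) atTop (𝓝 0) := by
    have := (hδ.const_mul (|t| ^ 3)).mul hV
    simpa using this
  have hsmall : ∀ᶠ n in atTop, |t| * δ n ≤ 1 := by
    have := hδ.const_mul |t|
    rw [mul_zero] at this
    exact this.eventually (eventually_le_nhds one_pos)
  have hdiff : Tendsto (fun n : ℕ => (n : ℂ) * (charFun (P.map (η n)) t - 1)
      - (t * (n * ∫ ω, η n ω ∂P : ℝ) * Complex.I - t ^ 2 / 2 * (n * ∫ ω, η n ω ^ 2 ∂P : ℝ) : ℂ))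
      atTop (𝓝 0) := by
    refine squeeze_zero_norm' ?_ hrem
    filter_upwards [hsmall] with n hn
    have h1 := norm_charFun_sub_taylor_two_le (hident n 0).aemeasurable_snd (hb n) hn
    calc _ = ‖(n : ℂ) * (charFun (P.map (η n)) t - 1
          - (t * (∫ ω, η n ω ∂P : ℝ) * Complex.I - t ^ 2 / 2 * (∫ ω, η n ω ^ 2 ∂P : ℝ)))‖ := by
          congr 1; push_cast; ring
      _ ≤ n * (|t| ^ 3 * δ n * ∫ ω, η n ω ^ 2 ∂P) := by
          rw [norm_mul, Complex.norm_natCast]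
          exact mul_le_mul_of_nonneg_left h1 (Nat.cast_nonneg n)
      _ = _ := by ring
  simpa using hdiff.add hmain

/-- Convergence of characteristic functions to that of a nondegenerate normal law implies
convergence of distribution functions. -/
theorem tendsto_measureReal_le_of_tendsto_charFun {Ω : Type*} [MeasurableSpace Ω] {P : Measure Ω}
    [IsProbabilityMeasure P] {S : ℕ → Ω → ℝ} (hS : ∀ n, AEMeasurable (S n) P) {B V : ℝ} (hV : 0 < V)
    (h : ∀ t : ℝ, Tendsto (fun n => charFun (P.map (S n)) t) atTop
      (𝓝 (Complex.exp (t * B * Complex.I - V * t ^ 2 / 2)))) (t : ℝ) :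
    Tendsto (fun n => P.real {ω | S n ω ≤ t}) atTop
      (𝓝 (∫ y in Set.Iic t, 1 / √(2 * Real.pi * V) * Real.exp (-(y - B) ^ 2 / (2 * V)))) := by
  set v : NNReal := V.toNNReal with hv
  have hvV : (v : ℝ) = V := Real.coe_toNNReal _ hV.le
  have hv0 : v ≠ 0 := by
    rw [← NNReal.coe_ne_zero, hvV]; exact hV.ne'
  let ν : ℕ → ProbabilityMeasure ℝ := fun n =>
    ⟨P.map (S n), Measure.isProbabilityMeasure_map (hS n)⟩
  let γ : ProbabilityMeasure ℝ := ⟨gaussianReal B v, inferInstance⟩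
  have hconv : Tendsto ν atTop (𝓝 γ) := by
    refine ProbabilityMeasure.tendsto_iff_tendsto_charFun.2 fun s => ?_
    change Tendsto (fun n => charFun (P.map (S n)) s) atTop (𝓝 (charFun (gaussianReal B v) s))
    rw [charFun_gaussianReal]
    have := h s
    rw [← hvV] at this
    exact this
  have := nullSingletonClass_gaussianReal (μ := B) hv0
  -- Nondegeneracy enters here: the limit law has no atom at `t`, so every half-line is a continuity
  -- set.
  have hport := ProbabilityMeasure.tendsto_measure_of_null_frontier_of_tendsto' hconv
    (E := Set.Iic t) (by
      rw [frontier_Iic]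
      exact measure_singleton (μ := gaussianReal B v) t)
  have hreal := (ENNReal.tendsto_toReal (measure_ne_top (γ : Measure ℝ) (Set.Iic t))).comp hport
  have e1 : ((γ : Measure ℝ) (Set.Iic t)).toReal
      = ∫ y in Set.Iic t, 1 / √(2 * Real.pi * V) * Real.exp (-(y - B) ^ 2 / (2 * V)) := by
    change (gaussianReal B v (Set.Iic t)).toReal = _
    rw [gaussianReal_apply_eq_integral B hv0, ENNReal.toReal_ofReal]
    · simp_rw [gaussianPDFReal_def, hvV, one_div]
    · exact integral_nonneg fun y => gaussianPDFReal_nonneg _ _ _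
  rw [← e1]
  refine hreal.congr fun n => ?_
  change (P.map (S n) (Set.Iic t)).toReal = (P {ω | S n ω ≤ t}).toReal
  rw [Measure.map_apply_of_aemeasurable (hS n) measurableSet_Iic]
  rfl

theorem IsC2At.continuousAt {p : ℕ} {f : (Fin p → ℝ) → ℝ} {z : Fin p → ℝ} (hf : IsC2At f z) :
    ContinuousAt f z :=
  (hasFDerivAt_of_continuousAt_partial hf.first_exists fun i =>
    (eventually_continuousAt_of_continuousAt_partial (hf.second_exists.mono fun _ hx j => hx i j)
      (hf.second_continuousAt i)).self_of_nhds).continuousAt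

/-! ### Balls of an arbitrary norm and rescaling -/

namespace Seminorm

variable {p : ℕ} (N : Seminorm ℝ (Fin p → ℝ))

theorem continuous_pi : Continuous N := N.convexOn.locallyLipschitz.continuous

theorem isClosed_closedBall_pi (z : Fin p → ℝ) (r : ℝ) : IsClosed (N.closedBall z r) := by
  have : N.closedBall z r = (fun x => N (x - z)) ⁻¹' Set.Iic r := by
    ext x; simp [Seminorm.mem_closedBall]
  rw [this]
  exact isClosed_Iic.preimage (N.continuous_pi.comp (continuous_id.sub continuous_const))

theorem measurableSet_closedBall_pi (z : Fin p → ℝ) (r : ℝ) : MeasurableSet (N.closedBall z r) :=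
  (N.isClosed_closedBall_pi z r).measurableSet

variable {N}

/-- By compactness `N` has a positive lower bound `c` on the sup-norm unit sphere, and homogeneity
gives `R = c⁻¹`. -/
theorem exists_norm_le_of_mem_closedBall (hN : ∀ x, N x = 0 → x = 0) :
    ∃ R > 0, ∀ x ∈ N.closedBall 0 1, ‖x‖ ≤ R := by
  obtain ⟨c, hc, hcN⟩ := (isCompact_sphere (0 : Fin p → ℝ) 1).exists_forall_le'
    N.continuous_pi.continuousOn (a := 0) (fun x hx => by
      refine lt_of_le_of_ne (apply_nonneg N x) fun h => ?_
      rw [hN x h.symm] at hx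
      simp at hx)
  refine ⟨c⁻¹, inv_pos.2 hc, fun x hx => ?_⟩
  rw [Seminorm.mem_closedBall, sub_zero] at hx
  rcases eq_or_ne x 0 with rfl | hx0
  · simpa using hc.le
  have hn : 0 < ‖x‖ := norm_pos_iff.2 hx0
  have h1 := hcN (‖x‖⁻¹ • x) (by simp [norm_smul, hn.ne'])
  rw [map_smul_eq_mul, norm_inv, norm_norm, inv_mul_eq_div, le_div_iff₀ hn] at h1
  rw [← one_div, le_div_iff₀ hc]
  linarith

theorem isCompact_closedBall_pi (hN : ∀ x, N x = 0 → x = 0) : IsCompact (N.closedBall 0 1) := by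
  obtain ⟨R, -, hR⟩ := exists_norm_le_of_mem_closedBall hN
  refine Metric.isCompact_of_isClosed_isBounded (N.isClosed_closedBall_pi 0 1)
    (isBounded_iff_forall_norm_le.2 ⟨R, hR⟩)

theorem unitBallVolume_pos (hN : ∀ x, N x = 0 → x = 0) : 0 < unitBallVolume N := by
  refine ENNReal.toReal_pos ?_ (isCompact_closedBall_pi hN).measure_lt_top.ne
  have ho : IsOpen (N ⁻¹' Set.Iio 1) := isOpen_Iio.preimage N.continuous_pi
  have h0 : (0 : Fin p → ℝ) ∈ N ⁻¹' Set.Iio 1 := by simp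
  refine ((ho.measure_pos volume ⟨0, h0⟩).trans_le (measure_mono fun x hx => ?_)).ne'
  rw [Seminorm.mem_closedBall, sub_zero]
  exact le_of_lt hx

/-- Rescaling an integral over a ball to the unit ball. -/
theorem integral_indicator_closedBall_mul (W f : (Fin p → ℝ) → ℝ) (z : Fin p → ℝ) {μ : ℝ}
    (hμ : 0 < μ) :
    ∫ x, (N.closedBall z μ).indicator (fun y => W (μ⁻¹ • (y - z))) x * f x
      = μ ^ p * ∫ u in N.closedBall 0 1, W u * f (z + μ • u) := by
  set G : (Fin p → ℝ) → ℝ :=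
    fun x => (N.closedBall z μ).indicator (fun y => W (μ⁻¹ • (y - z))) x * f x with hG
  -- Substitution `x = z + μu`, with Jacobian `μ ^ p`.
  have h1 := Measure.integral_comp_smul volume (fun x => G (z + x)) μ
  rw [integral_add_left_eq_self G z, Module.finrank_fin_fun, abs_of_pos (by positivity),
    smul_eq_mul] at h1
  have h2 : ∫ u in N.closedBall 0 1, W u * f (z + μ • u) = ∫ u, G (z + μ • u) := by
    rw [← integral_indicator (N.measurableSet_closedBall_pi 0 1)]
    congr 1
    ext u
    have hmem : z + μ • u ∈ N.closedBall z μ ↔ u ∈ N.closedBall 0 1 := by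
      rw [Seminorm.mem_closedBall, Seminorm.mem_closedBall, add_sub_cancel_left, sub_zero,
        map_smul_eq_mul, Real.norm_eq_abs, abs_of_pos hμ]
      exact mul_le_iff_le_one_right hμ
    by_cases hu : u ∈ N.closedBall 0 1
    · simp only [hG, Set.indicator_of_mem hu, Set.indicator_of_mem (hmem.2 hu)]
      rw [add_sub_cancel_left, smul_smul, inv_mul_cancel₀ hμ.ne', one_smul]
    · simp only [hG, Set.indicator_of_notMem hu, Set.indicator_of_notMem (fun h => hu (hmem.1 h))]
      simp
  rw [h2, h1]
  field_simp

theorem volume_real_closedBall (z : Fin p → ℝ) {μ : ℝ} (hμ : 0 < μ) :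
    volume.real (N.closedBall z μ) = μ ^ p * unitBallVolume N := by
  have h := integral_indicator_closedBall_mul (N := N) (fun _ => 1) (fun _ => 1) z hμ
  simp only [mul_one] at h
  rw [integral_indicator (N.measurableSet_closedBall_pi z μ)] at h
  simpa [unitBallVolume] using h

end Seminorm

/-! ### Limits of kernel integrals as the bandwidth shrinks -/

section Asymptotics

variable {p : ℕ} {N : Seminorm ℝ (Fin p → ℝ)} {f : (Fin p → ℝ) → ℝ} {z : Fin p → ℝ}

theorem IsPdf.integrable (hf : IsPdf f) : Integrable f := by
  refine ⟨hf.measurable.aestronglyMeasurable, ?_⟩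
  rw [hasFiniteIntegral_iff_ofReal (Eventually.of_forall hf.nonneg), hf.lintegral_eq_one]
  exact ENNReal.one_lt_top

theorem integrableOn_bounded_mul {W g : (Fin p → ℝ) → ℝ} (hW : Measurable W) {C : ℝ}
    (hC : ∀ u ∈ N.closedBall 0 1, |W u| ≤ C) (hg : IntegrableOn g (N.closedBall 0 1)) :
    IntegrableOn (fun u => W u * g u) (N.closedBall 0 1) :=
  Integrable.bdd_mul (c := C) hg hW.aestronglyMeasurable
    ((ae_restrict_mem (N.measurableSet_closedBall_pi 0 1)).mono hC)

theorem Integrable.comp_add_smul (hf : Integrable f) (z : Fin p → ℝ) {μ : ℝ} (hμ : μ ≠ 0) :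
    Integrable fun u => f (z + μ • u) :=
  (hf.comp_add_left z).comp_smul hμ

/-- Dominated convergence: the ball is bounded, so for small `μ` all points `z + μu` lie where `|f|
≤ |f z| + 1`. It is applied with `W = K` and `W = K²`. -/
theorem tendsto_integral_kernel_mul (hN : ∀ x, N x = 0 → x = 0) (hf : Measurable f)
    (hfz : ContinuousAt f z) {W : (Fin p → ℝ) → ℝ} (hW : Measurable W) {C : ℝ}
    (hC : ∀ u ∈ N.closedBall 0 1, |W u| ≤ C) :
    Tendsto (fun μ : ℝ => ∫ u in N.closedBall 0 1, W u * f (z + μ • u)) (𝓝[>] 0)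
      (𝓝 (f z * ∫ u in N.closedBall 0 1, W u)) := by
  obtain ⟨R, hR, hRN⟩ := Seminorm.exists_norm_le_of_mem_closedBall hN
  have hS := N.measurableSet_closedBall_pi 0 1
  have hfin := (Seminorm.isCompact_closedBall_pi hN).measure_lt_top (μ := volume)
  obtain ⟨δ, hδ, hball⟩ := Metric.eventually_nhds_iff_ball.1
    (hfz.eventually (Metric.closedBall_mem_nhds (f z) one_pos))
  rw [mul_comm, ← integral_mul_const]
  refine tendsto_integral_filter_of_dominated_convergence (fun _ => C * (|f z| + 1)) ?_ ?_ ?_ ?_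
  · refine Eventually.of_forall fun μ => Measurable.aestronglyMeasurable ?_
    exact hW.mul (hf.comp (by fun_prop))
  · filter_upwards [Ioo_mem_nhdsGT (div_pos hδ hR)] with μ hμ
    filter_upwards [ae_restrict_mem hS] with u hu
    have h1 : z + μ • u ∈ Metric.ball z δ := by
      rw [mem_ball_iff_norm, add_sub_cancel_left, norm_smul, Real.norm_eq_abs, abs_of_pos hμ.1]
      calc μ * ‖u‖ ≤ μ * R := mul_le_mul_of_nonneg_left (hRN u hu) hμ.1.le
        _ < δ := (lt_div_iff₀ hR).1 hμ.2
    have h2 := hball _ h1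
    rw [Real.dist_eq] at h2
    rw [norm_mul, Real.norm_eq_abs, Real.norm_eq_abs]
    have h3 : |f (z + μ • u)| ≤ |f z| + 1 := by
      have := abs_sub_abs_le_abs_sub (f (z + μ • u)) (f z)
      linarith
    exact mul_le_mul (hC u hu) h3 (abs_nonneg _) ((abs_nonneg _).trans (hC u hu))
  · exact integrableOn_const hfin.ne
  · refine Eventually.of_forall fun u => ?_
    have h1 : Tendsto (fun μ : ℝ => z + μ • u) (𝓝[>] 0) (𝓝 z) := by
      have : Continuous (fun μ : ℝ => z + μ • u) := by fun_prop
      have h := this.tendsto 0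
      rw [zero_smul, add_zero] at h
      exact h.mono_left nhdsWithin_le_nhds
    exact (hfz.tendsto.comp h1).const_mul (W u)

variable {K : (Fin p → ℝ) → ℝ}

theorem IsKernel.exists_abs_le (hK : IsKernel N K) :
    ∃ C, 0 ≤ C ∧ ∀ u ∈ N.closedBall 0 1, |K u| ≤ C := by
  obtain ⟨C, hC⟩ := hK.bounded
  refine ⟨max C 0, le_max_right _ _, fun u hu => ?_⟩
  rw [abs_of_nonneg (hK.nonneg u hu)]
  exact (hC u hu).trans (le_max_left _ _)

theorem IsKernel.integrableOn (hN : ∀ x, N x = 0 → x = 0) (hK : IsKernel N K) :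
    IntegrableOn K (N.closedBall 0 1) := by
  obtain ⟨C, -, hC⟩ := hK.exists_abs_le
  have := integrableOn_bounded_mul hK.measurable hC
    (integrableOn_const (C := (1 : ℝ)) (Seminorm.isCompact_closedBall_pi hN).measure_lt_top.ne)
  simpa using this

theorem IsKernel.integral_mul_linear (hN : ∀ x, N x = 0 → x = 0) (hK : IsKernel N K)
    (L : (Fin p → ℝ) →L[ℝ] ℝ) : ∫ u in N.closedBall 0 1, K u * L u = 0 := by
  obtain ⟨C, -, hC⟩ := hK.exists_abs_le
  have hid : IntegrableOn (fun u : Fin p → ℝ => u) (N.closedBall 0 1) :=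
    continuous_id.continuousOn.integrableOn_compact (Seminorm.isCompact_closedBall_pi hN)
  have hint : IntegrableOn (fun u => K u • u) (N.closedBall 0 1) :=
    Integrable.bdd_smul hid C hK.measurable.aestronglyMeasurable
      ((ae_restrict_mem (N.measurableSet_closedBall_pi 0 1)).mono hC)
  have h := L.integral_comp_comm hint
  rw [hK.first_moment_eq_zero, map_zero] at h
  simpa using h

/-- The second order expansion of the smoothed density. -/
theorem IsKernel.tendsto_bias (hN : ∀ x, N x = 0 → x = 0) (hK : IsKernel N K) (hf : IsPdf f)
    (hf2 : IsC2At f z) :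
    Tendsto (fun μ : ℝ => ((∫ u in N.closedBall 0 1, K u * f (z + μ • u))
        - unitBallVolume N * f z) / μ ^ 2) (𝓝[>] 0)
      (𝓝 (1 / 2 * ∫ u in N.closedBall 0 1, (u ⬝ᵥ (hessian f z *ᵥ u)) * K u)) := by
  obtain ⟨R, hR, hRN⟩ := Seminorm.exists_norm_le_of_mem_closedBall hN
  obtain ⟨C, hC0, hC⟩ := hK.exists_abs_le
  obtain ⟨L, hL⟩ := hf2.taylor
  have hS := N.measurableSet_closedBall_pi 0 1
  have hcomp := Seminorm.isCompact_closedBall_pi hN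
  set Q : (Fin p → ℝ) → ℝ := fun u => u ⬝ᵥ (hessian f z *ᵥ u) with hQ
  have hQc : Continuous Q := by
    simp only [hQ]
    exact continuous_id.dotProduct (continuous_const.matrix_mulVec continuous_id)
  have hQs : ∀ (μ : ℝ) u, Q (μ • u) = μ ^ 2 * Q u := fun μ u => by
    simp only [hQ, Matrix.mulVec_smul, smul_dotProduct, dotProduct_smul, smul_eq_mul]
    ring
  -- The linear term is subtracted before dividing by `μ²`, where it would blow up; this is free
  -- because it integrates to zero against `K`.
  have hrem : ∀ ε > 0, ∃ δ > 0, ∀ μ ∈ Set.Ioo 0 δ, ∀ u ∈ N.closedBall 0 1,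
      |(f (z + μ • u) - f z - μ * L u) / μ ^ 2 - 1 / 2 * Q u| ≤ ε * ‖u‖ ^ 2 := by
    intro ε hε
    obtain ⟨δ, hδ, h⟩ := hL ε hε
    refine ⟨δ / R, div_pos hδ hR, fun μ hμ u hu => ?_⟩
    have hμ2 : 0 < μ ^ 2 := pow_pos hμ.1 2
    have hn : ‖μ • u‖ = μ * ‖u‖ := by
      rw [norm_smul, Real.norm_eq_abs, abs_of_pos hμ.1]
    have h1 := h (μ • u) (by
      rw [hn]
      calc μ * ‖u‖ ≤ μ * R := mul_le_mul_of_nonneg_left (hRN u hu) hμ.1.le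
        _ < δ := (lt_div_iff₀ hR).1 hμ.2)
    change |f (z + μ • u) - f z - L (μ • u) - 1 / 2 * Q (μ • u)| ≤ _ at h1
    rw [hn, hQs, map_smul, smul_eq_mul] at h1
    have e : (f (z + μ • u) - f z - μ * L u) / μ ^ 2 - 1 / 2 * Q u
        = (f (z + μ • u) - f z - μ * L u - 1 / 2 * (μ ^ 2 * Q u)) / μ ^ 2 := by
      have := hμ.1.ne'
      field_simp
    rw [e, abs_div, abs_of_pos hμ2, div_le_iff₀ hμ2]
    refine h1.trans_eq ?_
    ring
  have hlim : Tendsto (fun μ : ℝ => ∫ u in N.closedBall 0 1,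
      K u * ((f (z + μ • u) - f z - μ * L u) / μ ^ 2)) (𝓝[>] 0)
      (𝓝 (∫ u in N.closedBall 0 1, K u * (1 / 2 * Q u))) := by
    refine tendsto_integral_filter_of_dominated_convergence
      (fun u => C * (|1 / 2 * Q u| + 1 * ‖u‖ ^ 2)) ?_ ?_ ?_ ?_
    · refine Eventually.of_forall fun μ => Measurable.aestronglyMeasurable ?_
      refine hK.measurable.mul (Measurable.div_const (Measurable.sub (Measurable.sub
        (hf.measurable.comp ?_) measurable_const) ?_) _)
      · fun_prop
      · fun_prop
    -- The Taylor bound with `ε = 1` already supplies a dominating function.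
    · obtain ⟨δ, hδ, h⟩ := hrem 1 one_pos
      filter_upwards [Ioo_mem_nhdsGT hδ] with μ hμ
      filter_upwards [ae_restrict_mem hS] with u hu
      rw [norm_mul, Real.norm_eq_abs, Real.norm_eq_abs]
      have h1 := h μ hμ u hu
      have h2 := abs_sub_abs_le_abs_sub ((f (z + μ • u) - f z - μ * L u) / μ ^ 2) (1 / 2 * Q u)
      exact mul_le_mul (hC u hu) (by linarith) (abs_nonneg _) hC0
    · have : Continuous fun u => C * (|1 / 2 * Q u| + 1 * ‖u‖ ^ 2) := by fun_prop
      exact this.continuousOn.integrableOn_compact hcomp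
    · filter_upwards [ae_restrict_mem hS] with u hu
      refine Tendsto.const_mul _ (Metric.tendsto_nhds.2 fun ε hε => ?_)
      obtain ⟨δ, hδ, h⟩ := hrem (ε / (‖u‖ ^ 2 + 1)) (by positivity)
      filter_upwards [Ioo_mem_nhdsGT hδ] with μ hμ
      rw [Real.dist_eq]
      refine (h μ hμ u hu).trans_lt ?_
      rw [div_mul_eq_mul_div, div_lt_iff₀ (by positivity)]
      nlinarith
  have hval : ∫ u in N.closedBall 0 1, K u * (1 / 2 * Q u)
      = 1 / 2 * ∫ u in N.closedBall 0 1, Q u * K u := by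
    rw [← integral_const_mul]
    congr 1
    ext u
    ring
  rw [hval] at hlim
  refine hlim.congr' ?_
  filter_upwards [self_mem_nhdsWithin] with μ hμ
  have hμ0 : μ ≠ 0 := ne_of_gt hμ
  have i1 : IntegrableOn (fun u => K u * f (z + μ • u)) (N.closedBall 0 1) :=
    integrableOn_bounded_mul hK.measurable hC
      (Integrable.comp_add_smul hf.integrable z hμ0).integrableOn
  have i2 := (hK.integrableOn hN).mul_const (f z)
  have i3 : IntegrableOn (fun u => K u * L u) (N.closedBall 0 1) :=
    integrableOn_bounded_mul hK.measurable hC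
      (L.continuous.continuousOn.integrableOn_compact hcomp)
  have e : ∀ u, K u * ((f (z + μ • u) - f z - μ * L u) / μ ^ 2)
      = (K u * f (z + μ • u) - K u * f z - μ * (K u * L u)) / μ ^ 2 := fun u => by ring
  simp_rw [e]
  have e' := integral_sub (i1.sub i2) (i3.const_mul μ)
  simp only [Pi.sub_apply] at e'
  rw [integral_div, e', integral_sub i1 i2,
    integral_const_mul, hK.integral_mul_linear hN, integral_mul_const, hK.integral_eq, mul_zero,
    sub_zero]

theorem IsKernel.integral_sq_pos (hN : ∀ x, N x = 0 → x = 0) (hK : IsKernel N K) :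
    0 < ∫ u in N.closedBall 0 1, K u ^ 2 := by
  obtain ⟨C, -, hC⟩ := hK.exists_abs_le
  have hβ := Seminorm.unitBallVolume_pos hN
  have i1 := hK.integrableOn hN
  have i2 : IntegrableOn (fun u => K u * K u) (N.closedBall 0 1) :=
    integrableOn_bounded_mul hK.measurable hC i1
  have i3 : IntegrableOn (fun _ : Fin p → ℝ => (1 : ℝ)) (N.closedBall 0 1) :=
    integrableOn_const (Seminorm.isCompact_closedBall_pi hN).measure_lt_top.ne
  -- Integrating `(K - 1)² ≥ 0` with `∫ K = β` gives `∫ K² ≥ β > 0`.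
  have h : 0 ≤ ∫ u in N.closedBall 0 1, (K u * K u - 2 * K u + 1) :=
    integral_nonneg fun u => by
      have := sq_nonneg (K u - 1)
      simp only [Pi.zero_apply]
      linarith
  have h' := integral_add (i2.sub (i1.const_mul 2)) i3
  simp only [Pi.sub_apply] at h'
  rw [h', integral_sub i2 (i1.const_mul 2),
    integral_const_mul, hK.integral_eq] at h
  have h1 : ∫ _u in N.closedBall 0 1, (1 : ℝ) = unitBallVolume N := by simp [unitBallVolume]
  rw [h1] at h
  simp_rw [sq]
  linarith

end Asymptotics

/-! ### Bandwidth asymptotics -/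

/-- The consequences of `k = ⌊n μᵖ⌋ ~ a n ^ (4 / (p + 4))` for the smoothing parameters. -/
theorem bandwidth_asymptotics {p : ℕ} (hp : 1 ≤ p) {μ : ℕ → ℝ} (hμ : ∀ n, 0 < μ n) {k : ℕ → ℕ}
    (hk : ∀ n, k n = ⌊(n : ℝ) * μ n ^ p⌋₊) {a : ℝ} (ha : 0 < a)
    (hka : Tendsto (fun n : ℕ => (n : ℝ) ^ (-4 / ((p : ℝ) + 4)) * (k n : ℝ)) atTop (𝓝 a)) :
    Tendsto (fun n => (k n : ℝ)) atTop atTop ∧ Tendsto (fun n => (k n : ℝ) / n) atTop (𝓝 0) ∧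
    Tendsto (fun n => (k n : ℝ) / (n * μ n ^ p)) atTop (𝓝 1) ∧ Tendsto μ atTop (𝓝[>] 0) ∧
    Tendsto (fun n => √(k n : ℝ) * μ n ^ 2) atTop (𝓝 (a ^ (((p : ℝ) + 4) / (2 * (p : ℝ))))) := by
  have hp0 : (0 : ℝ) < p := by exact_mod_cast hp
  have hcast := tendsto_natCast_atTop_atTop (R := ℝ)
  have h1 : Tendsto (fun n => (k n : ℝ)) atTop atTop := by
    have h := (tendsto_rpow_atTop (y := 4 / ((p : ℝ) + 4)) (by positivity)).comp hcast
    refine (h.atTop_mul_pos ha hka).congr' ?_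
    filter_upwards [eventually_gt_atTop 0] with n hn
    have hn' : (0 : ℝ) < n := by exact_mod_cast hn
    simp only [Function.comp]
    rw [← mul_assoc, ← Real.rpow_add hn']
    have : 4 / ((p : ℝ) + 4) + -4 / ((p : ℝ) + 4) = 0 := by ring
    rw [this, Real.rpow_zero, one_mul]
  have h2 : Tendsto (fun n => (k n : ℝ) / n) atTop (𝓝 0) := by
    have h := (tendsto_rpow_neg_atTop (y := p / ((p : ℝ) + 4)) (by positivity)).comp hcast
    have h' := h.mul hka
    rw [zero_mul] at h'
    refine h'.congr' ?_
    filter_upwards [eventually_gt_atTop 0] with n hn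
    have hn' : (0 : ℝ) < n := by exact_mod_cast hn
    simp only [Function.comp]
    rw [← mul_assoc, ← Real.rpow_add hn']
    have : -((p : ℝ) / ((p : ℝ) + 4)) + -4 / ((p : ℝ) + 4) = -1 := by
      field_simp; ring
    rw [this, Real.rpow_neg_one, inv_mul_eq_div]
  have hle : ∀ n, (k n : ℝ) ≤ n * μ n ^ p := fun n => by
    rw [hk n]
    exact Nat.floor_le (mul_nonneg (Nat.cast_nonneg n) (pow_nonneg (hμ n).le p))
  have h3 : Tendsto (fun n => (k n : ℝ) / (n * μ n ^ p)) atTop (𝓝 1) := by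
    have := tendsto_nat_floor_div_atTop.comp (tendsto_atTop_mono hle h1)
    refine this.congr fun n => ?_
    simp only [Function.comp]
    rw [← hk n]
  have hkpos : ∀ᶠ n in atTop, 0 < (k n : ℝ) := h1.eventually_gt_atTop 0
  -- `μᵖ` is the quotient of `k/n` by `k/(n μᵖ)`.
  have h4 : Tendsto (fun n => μ n ^ p) atTop (𝓝 0) := by
    have := h2.div h3 one_ne_zero
    rw [zero_div] at this
    refine this.congr' ?_
    filter_upwards [hkpos, eventually_gt_atTop 0] with n hn hn0
    have hn' : (0 : ℝ) < n := by exact_mod_cast hn0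
    have := (hμ n).ne'
    simp only [Pi.div_apply]
    field_simp
  have hroot : ∀ n, μ n = (μ n ^ p) ^ (1 / (p : ℝ)) := fun n => by
    rw [← Real.rpow_natCast, ← Real.rpow_mul (hμ n).le, mul_one_div_cancel hp0.ne', Real.rpow_one]
  have h5 : Tendsto μ atTop (𝓝[>] 0) := by
    refine tendsto_nhdsWithin_iff.2 ⟨?_, Eventually.of_forall hμ⟩
    have h := h4.rpow_const (p := 1 / (p : ℝ)) (Or.inr (by positivity))
    rw [Real.zero_rpow (by positivity)] at h
    exact h.congr fun n => (hroot n).symm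
  refine ⟨h1, h2, h3, h5, ?_⟩
  -- The exponents are chosen so that the powers of `n` cancel, `k` keeps the exponent `1/2` and `μ`
  -- the exponent `2`; the product is `√k μ²`.
  have h6 := (hka.rpow_const (p := ((p : ℝ) + 4) / (2 * (p : ℝ))) (Or.inl ha.ne')).mul
    (h3.rpow_const (p := -(2 / (p : ℝ))) (Or.inl one_ne_zero))
  rw [Real.one_rpow, mul_one] at h6
  refine h6.congr' ?_
  filter_upwards [hkpos, eventually_gt_atTop 0] with n hn hn0
  have hn' : (0 : ℝ) < n := by exact_mod_cast hn0
  have hm := hμ n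
  rw [Real.mul_rpow (by positivity) hn.le, ← Real.rpow_mul hn'.le,
    Real.div_rpow hn.le (by positivity), Real.mul_rpow hn'.le (by positivity),
    ← Real.rpow_natCast (μ n) p, ← Real.rpow_mul hm.le,
    div_eq_mul_inv ((k n : ℝ) ^ (-(2 / (p : ℝ)))), mul_inv,
    ← Real.rpow_neg hn'.le, ← Real.rpow_neg hm.le, neg_neg, Real.sqrt_eq_rpow,
    ← Real.rpow_natCast (μ n) 2]
  have e1 : -((p : ℝ) * -(2 / (p : ℝ))) = ((2 : ℕ) : ℝ) := by
    field_simp; norm_num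
  have e2 : -4 / ((p : ℝ) + 4) * (((p : ℝ) + 4) / (2 * (p : ℝ))) = -(2 / (p : ℝ)) := by
    field_simp; norm_num
  have e3 : (1 / 2 : ℝ) = ((p : ℝ) + 4) / (2 * (p : ℝ)) + -(2 / (p : ℝ)) := by
    field_simp; ring
  rw [e1, e2, e3, Real.rpow_add hn]
  have e4 : (n : ℝ) ^ (-(2 / (p : ℝ))) * (n : ℝ) ^ (2 / (p : ℝ)) = 1 := by
    rw [← Real.rpow_add hn', neg_add_cancel, Real.rpow_zero]
  linear_combination ((k n : ℝ) ^ (((p : ℝ) + 4) / (2 * (p : ℝ))) *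
    (k n : ℝ) ^ (-(2 / (p : ℝ))) * μ n ^ ((2 : ℕ) : ℝ)) * e4

/-! ### Moments of a single kernel weight -/

/-- The contribution of a single observation to the kernel mass. -/
noncomputable def kernelWeight {p : ℕ} (N : Seminorm ℝ (Fin p → ℝ)) (K : (Fin p → ℝ) → ℝ) (μ : ℝ)
    (z : Fin p → ℝ) : (Fin p → ℝ) → ℝ :=
  (N.closedBall z μ).indicator fun y => K (μ⁻¹ • (y - z))

section KernelWeight

variable {p : ℕ} {N : Seminorm ℝ (Fin p → ℝ)} {K f : (Fin p → ℝ) → ℝ} {z : Fin p → ℝ} {μ : ℝ}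

theorem measurable_kernelWeight (hK : Measurable K) : Measurable (kernelWeight N K μ z) :=
  (hK.comp (by fun_prop)).indicator (N.measurableSet_closedBall_pi z μ)

theorem abs_kernelWeight_le {C : ℝ} (hC0 : 0 ≤ C) (hC : ∀ u ∈ N.closedBall 0 1, |K u| ≤ C)
    (hμ : 0 < μ) (x : Fin p → ℝ) : |kernelWeight N K μ z x| ≤ C := by
  by_cases hx : x ∈ N.closedBall z μ
  · rw [kernelWeight, Set.indicator_of_mem hx]
    refine hC _ ?_
    rw [Seminorm.mem_closedBall] at hx ⊢
    rw [sub_zero, map_smul_eq_mul, norm_inv, Real.norm_eq_abs, abs_of_pos hμ, inv_mul_le_one₀ hμ]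
    exact hx
  · rw [kernelWeight, Set.indicator_of_notMem hx, abs_zero]
    exact hC0

theorem integral_kernelWeight_pow {Ω : Type*} [MeasurableSpace Ω] {P : Measure Ω}
    {Y : Ω → Fin p → ℝ} (hf : IsPdf f)
    (hY : HasLaw Y (volume.withDensity fun x => ENNReal.ofReal (f x)) P) (hK : Measurable K)
    (hμ : 0 < μ) {m : ℕ} (hm : m ≠ 0) :
    ∫ ω, kernelWeight N K μ z (Y ω) ^ m ∂P
      = μ ^ p * ∫ u in N.closedBall 0 1, K u ^ m * f (z + μ • u) := by
  have hmeas : Measurable fun x => kernelWeight N K μ z x ^ m :=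
    (measurable_kernelWeight hK).pow_const m
  have h1 := hY.integral_comp (f := fun x => kernelWeight N K μ z x ^ m)
    hmeas.aestronglyMeasurable
  have h2 := integral_withDensity_eq_integral_toReal_smul (μ := (volume : Measure (Fin p → ℝ)))
    (f := fun x => ENNReal.ofReal (f x)) hf.measurable.ennreal_ofReal
    (Eventually.of_forall fun _ => ENNReal.ofReal_lt_top) (fun x => kernelWeight N K μ z x ^ m)
  simp only [Function.comp] at h1
  rw [h1, h2, ← Seminorm.integral_indicator_closedBall_mul (fun u => K u ^ m) f z hμ]
  congr 1
  ext x
  rw [ENNReal.toReal_ofReal (hf.nonneg x), smul_eq_mul, mul_comm]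
  congr 1
  by_cases hx : x ∈ N.closedBall z μ
  · simp [kernelWeight, hx]
  -- Off the ball `0 ^ m = 0` requires `m ≠ 0`.
  · simp [kernelWeight, hx, hm]

end KernelWeight

/-! ### Asymptotic normality of the estimator -/

theorem mainTheorem5 {p : ℕ} (hp : 1 ≤ p)
    -- an arbitrary norm on `ℝᵖ`
    (N : Seminorm ℝ (Fin p → ℝ)) (hN : ∀ x, N x = 0 → x = 0)
    (f : (Fin p → ℝ) → ℝ) (hf : IsPdf f) (z : Fin p → ℝ) (hf2 : IsC2At f z)
    (hH : (hessian f z).det ≠ 0) (hfz : 0 < f z)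
    (K : (Fin p → ℝ) → ℝ) (hK : IsKernel N K)
    -- independent observations with density `f`
    {Ω : Type*} [MeasurableSpace Ω] (P : Measure Ω) [IsProbabilityMeasure P]
    (X : ℕ → Ω → Fin p → ℝ) (hX : iIndepFun X P)
    (hXf : ∀ j, HasLaw (X j) (volume.withDensity fun x => ENNReal.ofReal (f x)) P)
    -- the smoothing parameter `μ(n)` and the integer part `k(n)` of `n μ(n)ᵖ`
    (μ : ℕ → ℝ) (hμ : ∀ n, 0 < μ n) (k : ℕ → ℕ) (hk : ∀ n, k n = ⌊(n : ℝ) * μ n ^ p⌋₊)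
    (a : ℝ) (ha : 0 < a)
    (hka : Tendsto (fun n : ℕ => (n : ℝ) ^ (-4 / ((p : ℝ) + 4)) * (k n : ℝ)) atTop (𝓝 a)) :
    0 < kernelVariance N K f z ∧
    ∀ t : ℝ, Tendsto
      (fun n : ℕ => P.real {ω |
        √(k n : ℝ) * (kernelEstimator N K (μ n) n (fun j => X j ω) z - f z) ≤ t})
      atTop
      (𝓝 (∫ y in Set.Iic t, 1 / √(2 * Real.pi * kernelVariance N K f z) *
        Real.exp (-(y - kernelBias N K f a z) ^ 2 / (2 * kernelVariance N K f z)))) := by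
  have hβ := Seminorm.unitBallVolume_pos hN
  have hV : 0 < kernelVariance N K f z :=
    mul_pos hfz (mul_pos (by positivity) (hK.integral_sq_pos hN))
  refine ⟨hV, ?_⟩
  set β := unitBallVolume N with hβdef
  obtain ⟨C, hC0, hC⟩ := hK.exists_abs_le
  obtain ⟨hkinf, hkn, hkr, hμ0, hkμ⟩ := bandwidth_asymptotics hp hμ hk ha hka
  -- With this the identity `hsum` between row sums and `Z_n` also holds for `n = 0`.
  have hk0 : k 0 = 0 := by simp [hk 0]
  set I₁ : ℕ → ℝ := fun n => ∫ u in N.closedBall 0 1, K u * f (z + μ n • u) with hI₁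
  set I₂ : ℕ → ℝ := fun n => ∫ u in N.closedBall 0 1, K u ^ 2 * f (z + μ n • u) with hI₂
  have hI₁lim : Tendsto I₁ atTop (𝓝 (f z * β)) := by
    have := (tendsto_integral_kernel_mul hN hf.measurable hf2.continuousAt hK.measurable hC).comp hμ0
    rwa [hK.integral_eq] at this
  have hI₂lim : Tendsto I₂ atTop (𝓝 (f z * ∫ u in N.closedBall 0 1, K u ^ 2)) :=
    (tendsto_integral_kernel_mul hN hf.measurable hf2.continuousAt (hK.measurable.pow_const 2)
      (C := C ^ 2) fun u hu => by
        rw [abs_pow]; exact pow_le_pow_left₀ (abs_nonneg _) (hC u hu) 2).comp hμ0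
  have hbias := (hK.tendsto_bias hN hf hf2).comp hμ0
  -- `c` carries the normalization `√k / (n λ(S(μ)))`, and `e` spreads the centring `√k f(z)` evenly
  -- over the `n` summands.
  set c : ℕ → ℝ := fun n => √(k n : ℝ) / (n * (μ n ^ p * β)) with hc
  set e : ℕ → ℝ := fun n => √(k n : ℝ) * f z / n with he
  set Y : ℕ → ℕ → Ω → ℝ := fun n j ω => kernelWeight N K (μ n) z (X j ω)
  have hXm : ∀ j, AEMeasurable (X j) P := fun j => (hXf j).aemeasurable
  have hYm : ∀ n j, AEMeasurable (Y n j) P := fun n j =>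
    (measurable_kernelWeight hK.measurable).comp_aemeasurable (hXm j)
  have hYb : ∀ n j ω, |Y n j ω| ≤ C := fun n j ω => abs_kernelWeight_le hC0 hC (hμ n) _
  have hYi : ∀ n, Integrable (Y n 0) P := fun n =>
    Integrable.of_bound (hYm n 0).aestronglyMeasurable C (Eventually.of_forall (hYb n 0))
  have hY2i : ∀ n, Integrable (fun ω => Y n 0 ω ^ 2) P := fun n => by
    refine Integrable.of_bound ((hYm n 0).pow_const 2).aestronglyMeasurable (C ^ 2)
      (Eventually.of_forall fun ω => ?_)
    rw [Real.norm_eq_abs, abs_pow]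
    exact pow_le_pow_left₀ (abs_nonneg _) (hYb n 0 ω) 2
  have hEY : ∀ n, ∫ ω, Y n 0 ω ∂P = μ n ^ p * I₁ n := fun n => by
    have := integral_kernelWeight_pow (N := N) (z := z) hf (hXf 0) hK.measurable (hμ n) one_ne_zero
    simpa using this
  have hEY2 : ∀ n, ∫ ω, Y n 0 ω ^ 2 ∂P = μ n ^ p * I₂ n := fun n =>
    integral_kernelWeight_pow (N := N) (z := z) hf (hXf 0) hK.measurable (hμ n) two_ne_zero
  set ξ : ℕ → ℕ → Ω → ℝ := fun n j ω => c n * Y n j ω - e n with hξ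
  have hφm : ∀ n, Measurable fun x => c n * kernelWeight N K (μ n) z x - e n := fun n =>
    ((measurable_kernelWeight hK.measurable).const_mul _).sub_const _
  have hξm : ∀ n j, AEMeasurable (ξ n j) P := fun n j => ((hYm n j).const_mul _).sub_const _
  have hindep : ∀ n, iIndepFun (ξ n) P := fun n =>
    hX.comp (fun _ x => c n * kernelWeight N K (μ n) z x - e n) fun _ => hφm n
  have hident : ∀ n j, IdentDistrib (ξ n j) (ξ n 0) P P := fun n j =>
    (IdentDistrib.mk (hXm j) (hXm 0) ((hXf j).map_eq.trans (hXf 0).map_eq.symm)).comp (hφm n)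
  have hcnn : ∀ n, 0 ≤ c n := fun n => by have := hμ n; positivity
  have henn : ∀ n, 0 ≤ e n := fun n => by positivity
  have hsqrt : Tendsto (fun n => (√(k n : ℝ))⁻¹) atTop (𝓝 0) :=
    tendsto_inv_atTop_zero.comp (Real.tendsto_sqrt_atTop.comp hkinf)
  -- `c = (k / (n μᵖ)) · k^(-1/2) · β⁻¹`, and likewise `e = (k/n) · k^(-1/2) · f z`.
  have hclim : Tendsto c atTop (𝓝 0) := by
    have := (hkr.mul hsqrt).mul_const β⁻¹
    rw [mul_zero, zero_mul] at this
    refine this.congr fun n => ?_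
    simp only [hc]
    rw [div_mul_eq_mul_div, ← div_eq_mul_inv (k n : ℝ), Real.div_sqrt, ← div_eq_mul_inv, div_div, mul_assoc]
  have helim : Tendsto e atTop (𝓝 0) := by
    have := (hkn.mul hsqrt).mul_const (f z)
    rw [mul_zero, zero_mul] at this
    refine this.congr fun n => ?_
    simp only [he]
    rw [div_mul_eq_mul_div, ← div_eq_mul_inv (k n : ℝ), Real.div_sqrt, div_mul_eq_mul_div]
  have hδ : Tendsto (fun n => c n * C + e n) atTop (𝓝 0) := by
    have := (hclim.mul_const C).add helim
    rwa [zero_mul, add_zero] at this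
  have hb : ∀ n, ∀ᵐ ω ∂P, |ξ n 0 ω| ≤ c n * C + e n := fun n => Eventually.of_forall fun ω => by
    refine (abs_sub _ _).trans ?_
    rw [abs_mul, abs_of_nonneg (hcnn n), abs_of_nonneg (henn n)]
    exact add_le_add_left (mul_le_mul_of_nonneg_left (hYb n 0 ω) (hcnn n)) _
  have hEξ : ∀ n, ∫ ω, ξ n 0 ω ∂P = c n * (μ n ^ p * I₁ n) - e n := fun n => by
    simp only [hξ]
    rw [integral_sub ((hYi n).const_mul _) (integrable_const _), integral_const_mul, hEY]
    simp
  have hEξ2 : ∀ n, ∫ ω, ξ n 0 ω ^ 2 ∂P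
      = c n ^ 2 * (μ n ^ p * I₂ n) - 2 * c n * e n * (μ n ^ p * I₁ n) + e n ^ 2 := fun n => by
    have hexpand : ∀ ω, ξ n 0 ω ^ 2
        = c n ^ 2 * Y n 0 ω ^ 2 - 2 * c n * e n * Y n 0 ω + e n ^ 2 := fun ω => by
      simp only [hξ]; ring
    have h := integral_add (((hY2i n).const_mul (c n ^ 2)).sub ((hYi n).const_mul (2 * c n * e n)))
      (integrable_const (e n ^ 2))
    simp only [Pi.sub_apply] at h
    simp_rw [hexpand]
    rw [h, integral_sub ((hY2i n).const_mul _) ((hYi n).const_mul _), integral_const_mul,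
      integral_const_mul, hEY, hEY2]
    simp
  have hBlim : Tendsto (fun n : ℕ => n * ∫ ω, ξ n 0 ω ∂P) atTop (𝓝 (kernelBias N K f a z)) := by
    -- `n E ξ = √k β⁻¹ (I₁ - β f z)`; the factor `μ²` is inserted and divided out.
    have h := (hkμ.mul hbias).mul_const β⁻¹
    have e1 : a ^ (((p : ℝ) + 4) / (2 * (p : ℝ))) * (1 / 2 *
        ∫ u in N.closedBall 0 1, (u ⬝ᵥ (hessian f z *ᵥ u)) * K u) * β⁻¹
        = kernelBias N K f a z := by
      rw [kernelBias, ← hβdef]; ring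
    rw [e1] at h
    refine h.congr' ?_
    filter_upwards [eventually_gt_atTop 0] with n hn
    have hn' : (n : ℝ) ≠ 0 := by exact_mod_cast hn.ne'
    have hm := (hμ n).ne'
    rw [hEξ]
    simp only [Function.comp, hc, he]
    change √(k n : ℝ) * μ n ^ 2 * ((I₁ n - β * f z) / μ n ^ 2) * β⁻¹ = _
    field_simp
  have hVlim : Tendsto (fun n : ℕ => n * ∫ ω, ξ n 0 ω ^ 2 ∂P) atTop
      (𝓝 (kernelVariance N K f z)) := by
    -- After expanding the square, the cross term and the square of the centring carry a factor `k/n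
    -- → 0`, whereas `n c² μᵖ = (k / (n μᵖ)) β⁻²` tends to `β⁻²`.
    have h := (((hkr.mul hI₂lim).mul_const (β ^ 2)⁻¹).sub
      ((hkn.mul hI₁lim).mul_const (2 * f z * β⁻¹))).add (hkn.mul_const (f z ^ 2))
    have e1 : 1 * (f z * ∫ u in N.closedBall 0 1, K u ^ 2) * (β ^ 2)⁻¹
        - 0 * (f z * β) * (2 * f z * β⁻¹) + 0 * f z ^ 2 = kernelVariance N K f z := by
      rw [kernelVariance, ← hβdef]; ring
    rw [e1] at h
    refine h.congr' ?_
    filter_upwards [eventually_gt_atTop 0] with n hn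
    have hn' : (n : ℝ) ≠ 0 := by exact_mod_cast hn.ne'
    have hm := (hμ n).ne'
    have hs2 : √(k n : ℝ) ^ 2 = k n := Real.sq_sqrt (Nat.cast_nonneg _)
    rw [hEξ2]
    simp only [hc, he]
    generalize √(k n : ℝ) = s at hs2
    rw [← hs2]
    field_simp
  have hsum : ∀ n ω, ∑ j ∈ Finset.range n, ξ n j ω
      = √(k n : ℝ) * (kernelEstimator N K (μ n) n (fun j => X j ω) z - f z) := by
    intro n ω
    rcases Nat.eq_zero_or_pos n with rfl | hn
    · simp [hk0]
    have hn' : (n : ℝ) ≠ 0 := by exact_mod_cast hn.ne'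
    have hm := (hμ n).ne'
    rw [kernelEstimator, kernelMass, Seminorm.volume_real_closedBall z (hμ n)]
    change _ = √(k n : ℝ) * (1 / n * (∑ j ∈ Finset.range n, Y n j ω) / (μ n ^ p * β) - f z)
    simp only [hξ, Finset.sum_sub_distrib, ← Finset.mul_sum, Finset.sum_const, Finset.card_range,
      nsmul_eq_mul, hc, he]
    field_simp
  intro t
  have hchar := tendsto_charFun_sum_of_bounded hindep hident hδ hb hBlim hVlim
  have hfinal := tendsto_measureReal_le_of_tendsto_charFun
    (fun n => Finset.aemeasurable_fun_sum _ fun j _ => hξm n j) hV hchar t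
  simp_rw [hsum] at hfinal
  exact hfinal
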